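/- For an infinite sequence $T=(t_n)_{n\ge 1}$ of positive integers, let $w_0$ be the empty word and, for $k\ge 1$, let $w_k$ be obtained from $w_{k-1}$ by appending one letter $t_k$ and then $x-1$ further copies of $t_k$, where $x$ is the $k$-th letter of the word $w_{k-1}t_k$. Each $w_k$ is a prefix of $w_{k+1}$ and $|w_k|\ge k$; the sequence directed by $T$ is the infinite sequence $\mathcal O_T=\lim_{k\to\infty} w_k$. Thus the $k$-th block of $\mathcal O_T=(x_n)_{n\ge1}$ has length $x_k$ and is filled with the letter $t_k$. Theorem. Let $a\ge 2$ be an integer, let $p\in(0,1)$, and let $\mathbb T=(T_n)_{n\ge 1}$ be a Markov chain over the alphabet $\{1,a\}$ with initial value $T_1=1$ and with transition probability $p$ from $1$ to $a$ and from $a$ to $1$. Let $\mathbb X=(X_n)_{n\ge1}=\mathcal O_{\mathbb T}$ be the random sequence directed by $\mathbb T$, and let $|X_1\cdots X_n|_1$ denote the number of indices $i\le n$ with $X_i=1$. Then $$\lim_{n\to\infty}\mathbb P(X_n=1)=\frac12\qquad\text{and}\qquad \lim_{n\to\infty}\frac{\mathbb E\big(|X_1\cdots X_n|_1\big)}{n}=\frac12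 .$$ -/

import Mathlib

/-- The finite word `O_{t₁ ⋯ t_k}` directed by the first `k` letters of `t`, where `t i` is the
`(i+1)`-st letter of the directing sequence.  At step `k + 1` the letter `t k` is written once at
the end of the current word `w`, which gives a word `v` having at least `k + 1` letters; if `x` is
the `(k+1)`-st letter of `v`, then `x - 1` further copies of `t k` are written, so that the
`(k+1)`-st block is filled with `t k` and has length `x` (letters are positive integers).
The default value of `getD` is never used, see `le_length_directedWord`. -/
def directedWord (t : ℕ → ℕ) : ℕ → List ℕ
  | 0 => []
  | k + 1 =>
    let v := directedWord t k ++ [t k]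
    v ++ List.replicate (v.getD k 0 - 1) (t k)

theorem le_length_directedWord (t : ℕ → ℕ) (k : ℕ) : k ≤ (directedWord t k).length := by
  induction k with
  | zero => simp
  | succ k ih => simp only [directedWord, List.length_append, List.length_singleton]; omega

theorem directedWord_prefix (t : ℕ → ℕ) {j k : ℕ} (h : j ≤ k) :
    directedWord t j <+: directedWord t k := by
  induction k, h using Nat.le_induction with
  | base => exact List.prefix_refl _
  | succ k _ ih =>
    refine ih.trans ?_
    simp only [directedWord, List.append_assoc]
    exact List.prefix_append _ _

/-- The infinite sequence `O_T` directed by `t`, the limit of the words `directedWord t k`: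
`directedSeq t n` is its `(n+1)`-st letter. -/
def directedSeq (t : ℕ → ℕ) (n : ℕ) : ℕ :=
  (directedWord t (n + 1)).getD n 0

/-- Every word `directedWord t k` is a prefix of `directedSeq t`. -/
theorem getElem_directedWord (t : ℕ → ℕ) {n k : ℕ} (h : n < (directedWord t k).length) :
    (directedWord t k)[n] = directedSeq t n := by
  have h' : n < (directedWord t (n + 1)).length := le_length_directedWord t (n + 1)
  rw [directedSeq, List.getD_eq_getElem _ _ h']
  rcases le_total k (n + 1) with hk | hk
  · exact (directedWord_prefix t hk).getElem h
  · exact ((directedWord_prefix t hk).getElem h').symm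

/-- The number `|x₁ ⋯ x_n|_c` of occurrences of `c` among the first `n` letters of `x`
(`x i` is the `(i+1)`-st letter). -/
def letterCount (x : ℕ → ℕ) (c n : ℕ) : ℕ :=
  ((Finset.range n).filter (fun i => x i = c)).card

/-- `T 0, T 1, …` is a time-homogeneous Markov chain under `μ` with initial value `s₀` and
transition probabilities `K x y` (from `x` to `y`), on a countable discrete state space `S`: given
any history of positive probability ending in `x`, the next state is `y` with conditional
probability `K x y`. -/
structure IsMarkovChain {Ω S : Type*} [MeasurableSpace Ω] [MeasurableSpace S]
    [Countable S] [MeasurableSingletonClass S]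
    (μ : MeasureTheory.Measure Ω) (K : S → S → ℝ) (s₀ : S) (T : ℕ → Ω → S) : Prop where
  measurable : ∀ n, Measurable (T n)
  initial : ∀ᵐ ω ∂μ, T 0 ω = s₀
  transition : ∀ (n : ℕ) (s : ℕ → S) (y : S),
    μ {ω | ∀ i ≤ n, T i ω = s i} ≠ 0 →
      (ProbabilityTheory.cond μ {ω | ∀ i ≤ n, T i ω = s i}).real {ω | T (n + 1) ω = y}
        = K (s n) y

/-- The transition probabilities of the symmetric chain on `{1, a}`: from each of the two letters
the chain moves to the other one with probability `p` and stays with probability `1 - p`. -/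
def flipKernel (a : ℕ) (p : ℝ) (x y : ({1, a} : Set ℕ)) : ℝ :=
  if x = y then 1 - p else p

open MeasureTheory Filter Topology ProbabilityTheory

/-! ### The directed sequence -/

section Directed

variable {t : ℕ → ℕ}

/-! Count `1` as `+1` and `a` as `-1`; it suffices that the mean sign of `X n` tends to `0`, and
Cesàro averaging then gives the frequency. If `n` lies in block `k`, then `X n = T k`, but `k` is
random. The block lengths are letters of the directed sequence itself, and a prefix of `T`
determines a longer prefix of that sequence. Almost surely `a` recurs, so the surplus `|w_k| - k`
grows without bound (`eventually_add_le_length_directedWord`), and for large `n` the block of `n` is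
known `m` steps before its letter is drawn (`EarlyBlock`). Each step of the chain multiplies the
conditional mean sign by `1 - 2 * p` (`setIntegral_letterSign_succ`), so the mean is at most `|1 - 2
* p| ^ m` plus a vanishing probability, for every `m`. -/

theorem mem_directedWord {k c : ℕ} (h : c ∈ directedWord t k) : ∃ i, c = t i := by
  induction k with
  | zero => simp [directedWord] at h
  | succ k ih =>
    simp only [directedWord, List.mem_append, List.mem_singleton, List.mem_replicate] at h
    rcases h with (h | h) | h
    · exact ih h
    · exact ⟨k, h⟩
    · exact ⟨k, h.2⟩

theorem exists_directedSeq_eq (t : ℕ → ℕ) (n : ℕ) : ∃ i, directedSeq t n = t i := by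
  have h : n < (directedWord t (n + 1)).length := le_length_directedWord t (n + 1)
  rw [← getElem_directedWord t h]
  exact mem_directedWord (List.getElem_mem h)

theorem directedWord_succ (t : ℕ → ℕ) (k : ℕ) :
    directedWord t (k + 1) =
      directedWord t k ++ [t k] ++ List.replicate (directedSeq t k - 1) (t k) := by
  have hk : k < (directedWord t k ++ [t k]).length := by
    have := le_length_directedWord t k
    simp only [List.length_append, List.length_singleton]; omega
  have hp : directedWord t k ++ [t k] <+: directedWord t (k + 1) := by
    simp only [directedWord]
    exact List.prefix_append _ _
  have hx : (directedWord t k ++ [t k]).getD k 0 = directedSeq t k := by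
    rw [List.getD_eq_getElem _ _ hk, hp.getElem hk, getElem_directedWord]
  rw [← hx]
  rfl

theorem length_directedWord_succ (ht : ∀ i, 1 ≤ t i) (k : ℕ) :
    (directedWord t (k + 1)).length = (directedWord t k).length + directedSeq t k := by
  obtain ⟨i, hi⟩ := exists_directedSeq_eq t k
  have := ht i
  rw [directedWord_succ]
  simp only [List.length_append, List.length_singleton, List.length_replicate]
  omega

theorem length_directedWord_eq_sum (ht : ∀ i, 1 ≤ t i) (k : ℕ) :
    (directedWord t k).length = ∑ i ∈ Finset.range k, directedSeq t i := by
  induction k with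
  | zero => simp [directedWord]
  | succ k ih => rw [length_directedWord_succ ht, ih, Finset.sum_range_succ]

/-- Every step writes at least one letter, so the surplus `|w_k| - k` never decreases. -/
theorem length_directedWord_add_le (t : ℕ → ℕ) {j k : ℕ} (h : j ≤ k) :
    (directedWord t j).length + k ≤ (directedWord t k).length + j := by
  induction k, h using Nat.le_induction with
  | base => exact le_rfl
  | succ k _ ih =>
    rw [directedWord_succ]
    simp only [List.length_append, List.length_singleton]
    omega

theorem length_directedWord_mono (t : ℕ → ℕ) {j k : ℕ} (h : j ≤ k) :
    (directedWord t j).length ≤ (directedWord t k).length :=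
  (directedWord_prefix t h).length_le

/-- The `k`-th block of the directed sequence is filled with the letter `t k`. -/
theorem directedSeq_eq_of_mem_block {k n : ℕ} (h₁ : (directedWord t k).length ≤ n)
    (h₂ : n < (directedWord t (k + 1)).length) : directedSeq t n = t k := by
  rw [← getElem_directedWord t h₂]
  simp only [directedWord_succ, List.append_assoc]
  rw [List.getElem_append_right h₁]
  refine List.eq_of_mem_replicate (n := directedSeq t k - 1 + 1) ?_
  rw [List.replicate_succ, ← List.singleton_append]
  exact List.getElem_mem _

theorem exists_mem_block (t : ℕ → ℕ) (n : ℕ) :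
    ∃ k, (directedWord t k).length ≤ n ∧ n < (directedWord t (k + 1)).length := by
  have h : ∃ k, n < (directedWord t (k + 1)).length := ⟨n, le_length_directedWord t (n + 1)⟩
  refine ⟨Nat.find h, ?_, Nat.find_spec h⟩
  rcases hk : Nat.find h with _ | k
  · simp [directedWord]
  · exact not_lt.mp (Nat.find_min h (m := k) (by omega))

theorem mem_block_unique {j k n : ℕ} (hj : (directedWord t j).length ≤ n)
    (hj' : n < (directedWord t (j + 1)).length) (hk : (directedWord t k).length ≤ n)
    (hk' : n < (directedWord t (k + 1)).length) : j = k := by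
  rcases lt_trichotomy j k with h | h | h
  · exact absurd (length_directedWord_mono t (Nat.succ_le_of_lt h))
      (by simp only [Nat.succ_eq_add_one]; omega)
  · exact h
  · exact absurd (length_directedWord_mono t (Nat.succ_le_of_lt h))
      (by simp only [Nat.succ_eq_add_one]; omega)

theorem directedWord_congr {t' : ℕ → ℕ} {k : ℕ} (h : ∀ i < k, t i = t' i) :
    directedWord t k = directedWord t' k := by
  induction k with
  | zero => rfl
  | succ k ih =>
    simp only [directedWord]
    rw [ih fun i hi => h i (by omega), h k (by omega)]

/-- If the first `j` letters of the directing sequence already determine the first `k` letters of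
the directed sequence, then they determine the lengths of its first `k` blocks. -/
theorem length_directedWord_congr {t' : ℕ → ℕ} (ht : ∀ i, 1 ≤ t i) (ht' : ∀ i, 1 ≤ t' i)
    {j k : ℕ} (h : ∀ i < j, t i = t' i) (hk : k ≤ (directedWord t j).length) :
    (directedWord t k).length = (directedWord t' k).length := by
  rw [length_directedWord_eq_sum ht, length_directedWord_eq_sum ht']
  refine Finset.sum_congr rfl fun i hi => ?_
  have hi' : i < (directedWord t j).length := (Finset.mem_range.mp hi).trans_le hk
  have hw := directedWord_congr h
  rw [← getElem_directedWord t hi', ← getElem_directedWord t' (hw ▸ hi')]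
  simp only [hw]

/-- If letters different from `1` occur infinitely often in the directing sequence, then
the length of the `k`-th directed word exceeds `k` by an arbitrarily large amount. -/
theorem eventually_add_le_length_directedWord (ht : ∀ i, 1 ≤ t i)
    (hinf : ∀ N, ∃ i ≥ N, t i ≠ 1) (m : ℕ) :
    ∃ N, ∀ k ≥ N, k + m ≤ (directedWord t k).length := by
  induction m with
  | zero => exact ⟨0, fun k _ => le_length_directedWord t k⟩
  | succ m ih =>
    obtain ⟨N, hN⟩ := ih
    obtain ⟨i, hi, hti⟩ := hinf N
    -- Block `i` starts at position `q`, so letter `q` is `t i ≥ 2`; hence block `q` has length at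
    -- least `2` and raises the surplus by one.
    set q := (directedWord t i).length with hq
    have hiq : i ≤ q := le_length_directedWord t i
    have hx : directedSeq t q = t i := by
      refine directedSeq_eq_of_mem_block le_rfl ?_
      have := length_directedWord_add_le t (Nat.le_succ i)
      simp only [Nat.succ_eq_add_one] at this
      omega
    have h1 := ht i
    have hl := length_directedWord_succ ht q
    have hNq := hN q (by omega)
    refine ⟨q + 1, fun k hk => ?_⟩
    have := length_directedWord_add_le t hk
    omega

/-- The event that position `n` lies in block `j + m`, and that this can be read off from the
first `j + 1` letters of the directing sequence. -/
def EarlyBlock (m n j : ℕ) (t : ℕ → ℕ) : Prop :=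
  j + m + 1 ≤ (directedWord t (j + 1)).length ∧
    (directedWord t (j + m)).length ≤ n ∧ n < (directedWord t (j + m + 1)).length

theorem EarlyBlock.congr {m n j : ℕ} {t' : ℕ → ℕ} (ht : ∀ i, 1 ≤ t i) (ht' : ∀ i, 1 ≤ t' i)
    (h : ∀ i ≤ j, t i = t' i) (hE : EarlyBlock m n j t) : EarlyBlock m n j t' := by
  obtain ⟨h₁, h₂, h₃⟩ := hE
  have h' : ∀ i < j + 1, t i = t' i := fun i hi => h i (by omega)
  refine ⟨directedWord_congr h' ▸ h₁, ?_, ?_⟩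
  · rwa [← length_directedWord_congr ht ht' h' (by omega)]
  · rwa [← length_directedWord_congr ht ht' h' h₁]

theorem eventually_exists_earlyBlock (ht : ∀ i, 1 ≤ t i) (hinf : ∀ N, ∃ i ≥ N, t i ≠ 1)
    (m : ℕ) : ∀ᶠ n in atTop, ∃ j ∈ Finset.range (n + 1), EarlyBlock m n j t := by
  obtain ⟨N, hN⟩ := eventually_add_le_length_directedWord ht hinf m
  -- Beyond this position the block index is at least `N + m`, so its `m`-th predecessor is in the
  -- range of `hN`.
  filter_upwards [eventually_ge_atTop (directedWord t (N + m)).length] with n hn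
  obtain ⟨k, hk, hk'⟩ := exists_mem_block t n
  have hNk : N + m ≤ k := by
    by_contra! hlt
    exact absurd (length_directedWord_mono t (Nat.succ_le_of_lt hlt))
      (by simp only [Nat.succ_eq_add_one]; omega)
  have hkl := le_length_directedWord t k
  obtain ⟨j, rfl⟩ : ∃ j, k = j + m := ⟨k - m, by omega⟩
  refine ⟨j, Finset.mem_range.mpr (by omega), ?_, hk, hk'⟩
  have := hN (j + 1) (by omega)
  omega

end Directed

/-! ### The symmetric chain on two letters -/

/-- The letter `1` counts as `1` and every other letter as `-1`. -/
def letterSign (c : ℕ) : ℝ := if c = 1 then 1 else -1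

theorem abs_letterSign (c : ℕ) : |letterSign c| = 1 := by
  unfold letterSign; split_ifs <;> simp

theorem letterSign_eq (c : ℕ) : letterSign c = 2 * (if c = 1 then 1 else 0) - 1 := by
  unfold letterSign; split_ifs <;> norm_num

section Chain

variable {a : ℕ} {p : ℝ} {Ω : Type*} [MeasurableSpace Ω] {μ : Measure Ω}
  {T : ℕ → Ω → ({1, a} : Set ℕ)}

theorem one_le_letter (ha : 2 ≤ a) (s : ({1, a} : Set ℕ)) : 1 ≤ (s : ℕ) := by
  rcases s.2 with h | h
  · exact h.ge
  · rw [Set.mem_singleton_iff.mp h]; omega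

/-- An event that depends on the first `n + 1` states only is measurable. -/
theorem measurableSet_of_history (hm : ∀ n, Measurable (T n)) (n : ℕ)
    {P : (ℕ → ({1, a} : Set ℕ)) → Prop}
    (hP : ∀ s s', (∀ i ≤ n, s i = s' i) → P s → P s') :
    MeasurableSet {ω | P fun i => T i ω} := by
  have hH : Measurable fun ω (i : Fin (n + 1)) => T i ω := measurable_pi_lambda _ fun i => hm i
  have : {ω | P fun i => T i ω} = (fun ω (i : Fin (n + 1)) => T i ω) ⁻¹'
      -- A finite history is extended by repeating its last state; `P` ignores the extension.
      {h | P fun i => h ⟨min i n, by omega⟩} := by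
    ext ω
    exact ⟨hP _ _ fun i hi => by simp [hi], hP _ _ fun i hi => by simp [hi]⟩
  rw [this]
  exact hH (Set.to_countable _).measurableSet

theorem measurable_letterSign (n : ℕ) (hm : ∀ n, Measurable (T n)) :
    Measurable fun ω => letterSign (T n ω) :=
  (measurable_of_countable fun s : ({1, a} : Set ℕ) => letterSign s).comp (hm n)

theorem integrable_letterSign [IsFiniteMeasure μ] {x : Ω → ℕ}
    (h : Measurable fun ω => letterSign (x ω)) : Integrable (fun ω => letterSign (x ω)) μ :=
  Integrable.of_bound h.aestronglyMeasurable 1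
    (ae_of_all _ fun _ => (Real.norm_eq_abs _).trans_le (abs_letterSign _).le)

theorem setIntegral_letterSign [IsFiniteMeasure μ] {x : Ω → ℕ}
    (hx : MeasurableSet {ω | x ω = 1}) (F : Set Ω) :
    ∫ ω in F, letterSign (x ω) ∂μ = 2 * μ.real (F ∩ {ω | x ω = 1}) - μ.real F := by
  have : ∀ ω, letterSign (x ω) = 2 * ({ω | x ω = 1}.indicator (fun _ => (1 : ℝ)) ω) - 1 :=
    fun ω => by simp [letterSign_eq, Set.indicator_apply]
  simp_rw [this]
  rw [integral_sub (((integrable_const (1 : ℝ)).indicator hx).const_mul 2).integrableOn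
    (integrable_const _), integral_const_mul, integral_indicator hx, setIntegral_const,
    measureReal_restrict_apply hx, Set.inter_comm]
  simp

theorem measurableSet_letter_eq_one (hm : ∀ n, Measurable (T n)) (n : ℕ) :
    MeasurableSet {ω | (T n ω : ℕ) = 1} :=
  (measurable_subtype_coe.comp (hm n)) (measurableSet_singleton 1)

/-- On a cylinder the current state is constant, and the sign is an eigenvector of the kernel with
eigenvalue `1 - 2 * p`. Null cylinders, where `transition` says nothing, contribute zero. -/
theorem setIntegral_letterSign_succ_of_cylinder [IsProbabilityMeasure μ]
    (hT : IsMarkovChain μ (flipKernel a p) ⟨1, Set.mem_insert 1 {a}⟩ T)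
    (n : ℕ) (s : ℕ → ({1, a} : Set ℕ)) :
    ∫ ω in {ω | ∀ i ≤ n, T i ω = s i}, letterSign (T (n + 1) ω) ∂μ =
      (1 - 2 * p) * ∫ ω in {ω | ∀ i ≤ n, T i ω = s i}, letterSign (T n ω) ∂μ := by
  set F := {ω | ∀ i ≤ n, T i ω = s i} with hF
  have hFm : MeasurableSet F :=
    measurableSet_of_history hT.measurable n (P := fun r => ∀ i ≤ n, r i = s i)
      fun r r' h hr i hi => (h i hi).symm.trans (hr i hi)
  by_cases h0 : μ F = 0
  · rw [setIntegral_measure_zero _ h0, setIntegral_measure_zero _ h0, mul_zero]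
  have h1 := hT.transition n s ⟨1, Set.mem_insert 1 {a}⟩ h0
  have he : {ω | T (n + 1) ω = (⟨1, Set.mem_insert 1 {a}⟩ : ({1, a} : Set ℕ))} =
      {ω | (T (n + 1) ω : ℕ) = 1} := by
    ext ω; exact Subtype.ext_iff
  rw [← hF, he, Measure.real, cond_apply hFm, ENNReal.toReal_mul, ENNReal.toReal_inv,
    inv_mul_eq_iff_eq_mul₀ (ENNReal.toReal_pos h0 (measure_ne_top _ _)).ne'] at h1
  change μ.real _ = μ.real F * _ at h1
  have hr : ∫ ω in F, letterSign (T n ω) ∂μ = letterSign (s n) * μ.real F := by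
    rw [setIntegral_congr_fun (g := fun _ => letterSign (s n)) hFm
      fun _ hω => by simp only [hω n le_rfl]]
    simp [mul_comm]
  rw [setIntegral_letterSign (measurableSet_letter_eq_one hT.measurable _), hr, h1]
  have : 2 * flipKernel a p (s n) ⟨1, Set.mem_insert 1 {a}⟩ - 1 =
      (1 - 2 * p) * letterSign (s n) := by
    simp only [flipKernel, letterSign, Subtype.ext_iff]
    split_ifs <;> ring
  linear_combination μ.real F * this

/-- One step of the chain multiplies the mean of the sign by `1 - 2 * p`, conditionally on the
past. -/
theorem setIntegral_letterSign_succ [IsProbabilityMeasure μ]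
    (hT : IsMarkovChain μ (flipKernel a p) ⟨1, Set.mem_insert 1 {a}⟩ T)
    (n : ℕ) {P : (ℕ → ({1, a} : Set ℕ)) → Prop}
    (hP : ∀ s s', (∀ i ≤ n, s i = s' i) → P s → P s') :
    ∫ ω in {ω | P fun i => T i ω}, letterSign (T (n + 1) ω) ∂μ =
      (1 - 2 * p) * ∫ ω in {ω | P fun i => T i ω}, letterSign (T n ω) ∂μ := by
  classical
  let e : (Fin (n + 1) → ({1, a} : Set ℕ)) → ℕ → ({1, a} : Set ℕ) :=
    fun h i => h ⟨min i n, by omega⟩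
  let H : Finset (Fin (n + 1) → ({1, a} : Set ℕ)) := Finset.univ.filter fun h => P (e h)
  let F : (Fin (n + 1) → ({1, a} : Set ℕ)) → Set Ω := fun h => {ω | ∀ i ≤ n, T i ω = e h i}
  -- The event is a finite disjoint union of cylinders.
  have hU : {ω | P fun i => T i ω} = ⋃ h ∈ H, F h := by
    ext ω
    simp only [Set.mem_ofPred_eq, Set.mem_iUnion, H, F, Finset.mem_filter, Finset.mem_univ,
      true_and, exists_prop]
    constructor
    · intro hω
      have hi : ∀ i ≤ n, T i ω = e (fun i => T i ω) i := fun i hi => by simp [e, hi]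
      exact ⟨fun i => T i ω, hP _ _ hi hω, hi⟩
    · rintro ⟨h, hh, hω⟩
      exact hP _ _ (fun i hi => (hω i hi).symm) hh
  have hFm : ∀ h, MeasurableSet (F h) := fun h =>
    measurableSet_of_history hT.measurable n (P := fun r => ∀ i ≤ n, r i = e h i)
      fun r r' hr hr' i hi => (hr i hi).symm.trans (hr' i hi)
  have hd : Set.Pairwise (H : Set (Fin (n + 1) → ({1, a} : Set ℕ))) (Function.onFun Disjoint F) := by
    intro h _ h' _ hne
    refine Set.disjoint_left.mpr fun ω hω hω' => hne (funext fun i => ?_)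
    have := (hω i (by omega)).symm.trans (hω' i (by omega))
    simpa [e, Nat.le_of_lt_succ i.2] using this
  have hint : ∀ k, Integrable (fun ω => letterSign (T k ω)) μ := fun k =>
    integrable_letterSign (measurable_letterSign k hT.measurable)
  rw [hU, integral_biUnion_finset H (fun h _ => hFm h) hd fun h _ => (hint _).integrableOn,
    integral_biUnion_finset H (fun h _ => hFm h) hd fun h _ => (hint _).integrableOn,
    Finset.mul_sum]
  exact Finset.sum_congr rfl fun h _ => setIntegral_letterSign_succ_of_cylinder hT n (e h)

theorem setIntegral_letterSign_add [IsProbabilityMeasure μ]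
    (hT : IsMarkovChain μ (flipKernel a p) ⟨1, Set.mem_insert 1 {a}⟩ T)
    (n m : ℕ) {P : (ℕ → ({1, a} : Set ℕ)) → Prop}
    (hP : ∀ s s', (∀ i ≤ n, s i = s' i) → P s → P s') :
    ∫ ω in {ω | P fun i => T i ω}, letterSign (T (n + m) ω) ∂μ =
      (1 - 2 * p) ^ m * ∫ ω in {ω | P fun i => T i ω}, letterSign (T n ω) ∂μ := by
  induction m with
  | zero => simp
  | succ m ih =>
    rw [← add_assoc, setIntegral_letterSign_succ hT (n + m)
      fun s s' h => hP s s' fun i hi => h i (by omega), ih]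
    ring

/-- The sign is `1` throughout a run, so the one-step identity says that extending the run costs a
factor `1 - p`. -/
theorem measureReal_run_of_ones [IsProbabilityMeasure μ] (hp : p ∈ Set.Ioo (0 : ℝ) 1)
    (hT : IsMarkovChain μ (flipKernel a p) ⟨1, Set.mem_insert 1 {a}⟩ T) (N m : ℕ) :
    μ.real {ω | ∀ i, N ≤ i → i ≤ N + m → (T i ω : ℕ) = 1} ≤ (1 - p) ^ m := by
  induction m with
  | zero => simp
  | succ m ih =>
    set A : ℕ → Set Ω := fun m => {ω | ∀ i, N ≤ i → i ≤ N + m → (T i ω : ℕ) = 1} with hA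
    have hAm : ∀ m, MeasurableSet (A m) := fun m =>
      measurableSet_of_history hT.measurable (N + m)
        (P := fun r => ∀ i, N ≤ i → i ≤ N + m → (r i : ℕ) = 1)
        fun r r' h hr i hi hi' => h i hi' ▸ hr i hi hi'
    have hs := setIntegral_letterSign_succ hT (N + m)
        (P := fun r => ∀ i, N ≤ i → i ≤ N + m → (r i : ℕ) = 1)
        fun r r' h hr i hi hi' => h i hi' ▸ hr i hi hi'
    have hr : ∫ ω in A m, letterSign (T (N + m) ω) ∂μ = μ.real (A m) := by
      rw [setIntegral_congr_fun (g := fun _ => (1 : ℝ)) (hAm m) fun ω hω => by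
        simp [letterSign, hω (N + m) (by omega) le_rfl]]
      simp
    have he : A (m + 1) = A m ∩ {ω | (T (N + m + 1) ω : ℕ) = 1} := by
      ext ω
      refine ⟨fun h => ⟨fun i hi hi' => h i hi (by omega), h _ (by omega) (by omega)⟩,
        fun h i hi hi' => ?_⟩
      rcases Nat.lt_or_ge i (N + m + 1) with hlt | hge
      · exact h.1 i hi (by omega)
      · obtain rfl : i = N + m + 1 := by omega
        exact h.2
    change ∫ ω in A m, letterSign (T (N + m + 1) ω) ∂μ =
      (1 - 2 * p) * ∫ ω in A m, letterSign (T (N + m) ω) ∂μ at hs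
    rw [setIntegral_letterSign (measurableSet_letter_eq_one hT.measurable _), ← he, hr] at hs
    have ih' : μ.real (A m) ≤ (1 - p) ^ m := ih
    change μ.real (A (m + 1)) ≤ _
    calc μ.real (A (m + 1)) = (1 - p) * μ.real (A m) := by linarith
      _ ≤ (1 - p) * (1 - p) ^ m := mul_le_mul_of_nonneg_left ih' (by linarith [hp.2])
      _ = (1 - p) ^ (m + 1) := (pow_succ' _ _).symm

theorem ae_exists_letter_ne_one [IsProbabilityMeasure μ] (hp : p ∈ Set.Ioo (0 : ℝ) 1)
    (hT : IsMarkovChain μ (flipKernel a p) ⟨1, Set.mem_insert 1 {a}⟩ T) :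
    ∀ᵐ ω ∂μ, ∀ N, ∃ i ≥ N, (T i ω : ℕ) ≠ 1 := by
  refine ae_all_iff.mpr fun N => ?_
  have hle : ∀ m : ℕ, μ.real {ω | ¬∃ i ≥ N, (T i ω : ℕ) ≠ 1} ≤ (1 - p) ^ m := fun m =>
    (measureReal_mono fun ω hω i hi _ => by
      by_contra hne
      exact hω ⟨i, hi, hne⟩).trans (measureReal_run_of_ones hp hT N m)
  have hlim : Tendsto (fun m : ℕ => (1 - p) ^ m) atTop (𝓝 0) :=
    tendsto_pow_atTop_nhds_zero_of_lt_one (by linarith [hp.2]) (by linarith [hp.1])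
  have h0 := le_antisymm (ge_of_tendsto' hlim hle) measureReal_nonneg
  exact (measureReal_eq_zero_iff).mp h0

/-! ### Mean sign of the directed sequence -/

theorem measurableSet_earlyBlock (ha : 2 ≤ a) (hm : ∀ n, Measurable (T n)) (m n j : ℕ) :
    MeasurableSet {ω | EarlyBlock m n j fun i => (T i ω : ℕ)} :=
  measurableSet_of_history hm j (P := fun s => EarlyBlock m n j fun i => (s i : ℕ))
    fun s s' h hE => hE.congr (fun i => one_le_letter ha (s i)) (fun i => one_le_letter ha (s' i))
      fun i hi => by rw [h i hi]

theorem measurableSet_directedSeq_eq (hm : ∀ n, Measurable (T n)) (n c : ℕ) :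
    MeasurableSet {ω | directedSeq (fun k => (T k ω : ℕ)) n = c} :=
  measurableSet_of_history hm n (P := fun s => directedSeq (fun k => (s k : ℕ)) n = c)
    fun s s' h hs => by
      rw [← hs, directedSeq, directedSeq,
        directedWord_congr (t' := fun k => (s k : ℕ)) fun i hi => by rw [h i (by omega)]]

theorem measurable_letterSign_directedSeq (hm : ∀ n, Measurable (T n)) (n : ℕ) :
    Measurable fun ω => letterSign (directedSeq (fun k => (T k ω : ℕ)) n) := by
  unfold letterSign
  exact Measurable.ite (measurableSet_directedSeq_eq hm n 1) measurable_const measurable_const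

/-- The event depends only on the states up to time `j`, while the letter at `n` is the state `m`
steps later. -/
theorem abs_setIntegral_letterSign_directedSeq_le [IsProbabilityMeasure μ] (ha : 2 ≤ a)
    (hT : IsMarkovChain μ (flipKernel a p) ⟨1, Set.mem_insert 1 {a}⟩ T) (m n j : ℕ) :
    |∫ ω in {ω | EarlyBlock m n j fun i => (T i ω : ℕ)},
        letterSign (directedSeq (fun k => (T k ω : ℕ)) n) ∂μ| ≤
      |1 - 2 * p| ^ m * μ.real {ω | EarlyBlock m n j fun i => (T i ω : ℕ)} := by
  have hm := measurableSet_earlyBlock ha hT.measurable m n j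
  rw [setIntegral_congr_fun (g := fun ω => letterSign (T (j + m) ω)) hm fun ω hω => by
    simp only [directedSeq_eq_of_mem_block hω.2.1 hω.2.2]]
  have := setIntegral_letterSign_add hT j m
    (P := fun s => EarlyBlock m n j fun i => (s i : ℕ)) fun s s' h hE =>
      hE.congr (fun i => one_le_letter ha (s i)) (fun i => one_le_letter ha (s' i))
        fun i hi => by rw [h i hi]
  rw [this, abs_mul, abs_pow]
  refine mul_le_mul_of_nonneg_left ?_ (by positivity)
  have := norm_setIntegral_le_of_norm_le_const (μ := μ) (C := 1)
    (s := {ω | EarlyBlock m n j fun i => (T i ω : ℕ)}) (f := fun ω => letterSign (T j ω))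
    (measure_lt_top _ _) fun ω _ => (abs_letterSign _).le
  simpa using this

theorem abs_integral_letterSign_directedSeq_le [IsProbabilityMeasure μ] (ha : 2 ≤ a)
    (hT : IsMarkovChain μ (flipKernel a p) ⟨1, Set.mem_insert 1 {a}⟩ T) (m n : ℕ) :
    |∫ ω, letterSign (directedSeq (fun k => (T k ω : ℕ)) n) ∂μ| ≤ |1 - 2 * p| ^ m +
      μ.real (⋃ j ∈ Finset.range (n + 1), {ω | EarlyBlock m n j fun i => (T i ω : ℕ)})ᶜ := by
  set A : ℕ → Set Ω := fun j => {ω | EarlyBlock m n j fun i => (T i ω : ℕ)}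
  set G := ⋃ j ∈ Finset.range (n + 1), A j
  have hA : ∀ j, MeasurableSet (A j) := measurableSet_earlyBlock ha hT.measurable m n
  have hG : MeasurableSet G := Finset.measurableSet_biUnion _ fun j _ => hA j
  -- Position `n` lies in only one block, so `j + m` is determined.
  have hd : Set.Pairwise (Finset.range (n + 1) : Set ℕ) (Function.onFun Disjoint A) :=
    fun j _ j' _ hne => Set.disjoint_left.mpr fun ω h h' => hne <| by
      have := mem_block_unique h.2.1 h.2.2 h'.2.1 h'.2.2
      omega
  have hint := integrable_letterSign (μ := μ) (measurable_letterSign_directedSeq hT.measurable n)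
  rw [← integral_add_compl hG hint]
  refine (abs_add_le _ _).trans (add_le_add ?_ ?_)
  · rw [integral_biUnion_finset _ (fun j _ => hA j) hd fun j _ => hint.integrableOn]
    calc _ ≤ ∑ j ∈ Finset.range (n + 1), |1 - 2 * p| ^ m * μ.real (A j) :=
          (Finset.abs_sum_le_sum_abs _ _).trans <| Finset.sum_le_sum fun j _ =>
            abs_setIntegral_letterSign_directedSeq_le ha hT m n j
      _ = |1 - 2 * p| ^ m * μ.real G := by
          rw [← Finset.mul_sum, measureReal_biUnion_finset hd fun j _ => hA j]
      _ ≤ |1 - 2 * p| ^ m := mul_le_of_le_one_right (by positivity) measureReal_le_one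
  · have := norm_setIntegral_le_of_norm_le_const (μ := μ) (C := 1) (s := Gᶜ)
      (f := fun ω => letterSign (directedSeq (fun k => (T k ω : ℕ)) n))
      (measure_lt_top _ _) fun ω _ => (abs_letterSign _).le
    simpa using this

/-- Almost every `ω` lies in only finitely many of these complements, so their indicators tend to
`0` almost everywhere. -/
theorem tendsto_measureReal_compl_earlyBlock [IsProbabilityMeasure μ] (ha : 2 ≤ a)
    (hp : p ∈ Set.Ioo (0 : ℝ) 1)
    (hT : IsMarkovChain μ (flipKernel a p) ⟨1, Set.mem_insert 1 {a}⟩ T) (m : ℕ) :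
    Tendsto (fun n => μ.real
      (⋃ j ∈ Finset.range (n + 1), {ω | EarlyBlock m n j fun i => (T i ω : ℕ)})ᶜ)
      atTop (𝓝 0) := by
  have h := tendsto_measure_of_ae_tendsto_indicator_of_isFiniteMeasure (μ := μ) (A := ∅) atTop
    MeasurableSet.empty (As := fun n => (⋃ j ∈ Finset.range (n + 1),
      {ω | EarlyBlock m n j fun i => (T i ω : ℕ)})ᶜ)
    (fun n => (Finset.measurableSet_biUnion _ fun j _ =>
      measurableSet_earlyBlock ha hT.measurable m n j).compl) (by
    filter_upwards [ae_exists_letter_ne_one hp hT] with ω hω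
    filter_upwards [eventually_exists_earlyBlock (fun i => one_le_letter ha (T i ω)) hω m] with n hn
    obtain ⟨j, hj, hE⟩ := hn
    simp only [Set.mem_compl_iff, Set.mem_empty_iff_false, iff_false, not_not]
    exact Set.mem_biUnion hj hE)
  rw [measure_empty] at h
  exact (ENNReal.tendsto_toReal ENNReal.zero_ne_top).comp h

theorem tendsto_integral_letterSign_directedSeq [IsProbabilityMeasure μ] (ha : 2 ≤ a)
    (hp : p ∈ Set.Ioo (0 : ℝ) 1)
    (hT : IsMarkovChain μ (flipKernel a p) ⟨1, Set.mem_insert 1 {a}⟩ T) :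
    Tendsto (fun n => ∫ ω, letterSign (directedSeq (fun k => (T k ω : ℕ)) n) ∂μ)
      atTop (𝓝 0) := by
  rw [Metric.tendsto_atTop']
  intro ε hε
  have hlam : |1 - 2 * p| < 1 := abs_lt.mpr ⟨by linarith [hp.2], by linarith [hp.1]⟩
  -- The delay `m` is fixed first; only then does `n` tend to infinity.
  obtain ⟨m, hm⟩ := exists_pow_lt_of_lt_one (half_pos hε) hlam
  have := (tendsto_measureReal_compl_earlyBlock ha hp hT m).eventually (gt_mem_nhds (half_pos hε))
  obtain ⟨N, hN⟩ := eventually_atTop.mp this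
  refine ⟨N, fun n hn => ?_⟩
  rw [Real.dist_eq, sub_zero]
  have h₁ := abs_integral_letterSign_directedSeq_le ha hT m n
  have h₂ := hN n hn.le
  linarith

end Chain

theorem mainTheorem6 (a : ℕ) (ha : 2 ≤ a) (p : ℝ) (hp : p ∈ Set.Ioo (0 : ℝ) 1)
    {Ω : Type*} [MeasurableSpace Ω] (μ : MeasureTheory.Measure Ω)
    [MeasureTheory.IsProbabilityMeasure μ]
    (T : ℕ → Ω → ({1, a} : Set ℕ))
    (hT : IsMarkovChain μ (flipKernel a p) ⟨1, Set.mem_insert 1 {a}⟩ T)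
    (X : ℕ → Ω → ℕ) (hX : ∀ n ω, X n ω = directedSeq (fun k => (T k ω : ℕ)) n) :
    Filter.Tendsto (fun n : ℕ => μ.real {ω | X n ω = 1}) Filter.atTop (nhds (1 / 2)) ∧
    Filter.Tendsto
      (fun n : ℕ => (∫ ω, (letterCount (fun k => X k ω) 1 n : ℝ) ∂μ) / (n : ℝ))
      Filter.atTop (nhds (1 / 2)) := by
  obtain rfl : X = fun n ω => directedSeq (fun k => (T k ω : ℕ)) n := by
    funext n ω; exact hX n ω
  have hXm := measurableSet_directedSeq_eq hT.measurable
  have hprob : Tendsto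
      (fun n : ℕ => μ.real {ω | directedSeq (fun k => (T k ω : ℕ)) n = 1}) atTop (𝓝 (1 / 2)) := by
    have h := ((tendsto_integral_letterSign_directedSeq ha hp hT).add_const 1).div_const 2
    rw [zero_add] at h
    refine h.congr fun n => ?_
    rw [← setIntegral_univ, setIntegral_letterSign (hXm n 1), Set.univ_inter, probReal_univ]
    ring
  refine ⟨hprob, hprob.cesaro.congr fun n => ?_⟩
  have hcount : ∀ ω, (letterCount (fun k => directedSeq (fun k => (T k ω : ℕ)) k) 1 n : ℝ) =
      ∑ i ∈ Finset.range n,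
        {ω | directedSeq (fun k => (T k ω : ℕ)) i = 1}.indicator (fun _ => (1 : ℝ)) ω := by
    intro ω
    simp [letterCount, Set.indicator_apply]
  simp_rw [hcount]
  rw [integral_finsetSum _ fun i _ => (integrable_const (1 : ℝ)).indicator (hXm i 1),
    div_eq_inv_mul]
  congr 1
  refine Finset.sum_congr rfl fun i _ => ?_
  rw [integral_indicator (hXm i 1), setIntegral_const]
  simp
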